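/- **Theorem 1.6.** Conventions: $\mathbb{R}^d$ carries the standard inner product, and $\|\cdot\|$ is the associated operator norm of $d\times d$ matrices. For a finite nonempty set $A\subseteq\mathbb{R}^d$ put $\delta_A=\frac{1}{\#A}\sum_{a\in A}\delta_a$. Let $R$ be a $d\times d$ integer matrix all of whose eigenvalues have modulus strictly greater than $1$, and let $B\subseteq\mathbb{Z}^d$ be finite. The pair $(R,B)$ is *admissible* if there is a finite set $L\subseteq\mathbb{Z}^d$ with $\#L=\#B$ such that the matrix $$\left[\tfrac{1}{\sqrt{\#B}}\,e^{-2\pi i\,(R^{-1}b)\cdot \ell}\right]_{b\in B,\ \ell\in L}$$ is unitary. Let $\mathcal{D}_d$ be the set of all pairs $(R,B)$ with $R=\mathrm{diag}(m_1,\dots,m_d)$, where $m_1,\dots,m_d\ge 2$ are integers, and $B$ a nonempty subset of $\{0,\dots,m_1-1\}\times\cdots\times\{0,\dots,m_d-1\}$. Let $\{(R_n,B_n)\}_{n=1}^\infty\subseteq\mathcal{D}_d$ be a sequence of admissible pairs with $$\sup_{n\ge 1}\|R_n\|<\infty .$$ Then the measures $$\mu_n=\delta_{R_1^{-1}B_1}*\delta_{(R_2R_1)^{-1}B_2}*\cdots*\delta_{(R_n\cdots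 R_2R_1)^{-1}B_n}$$ converge weakly to a Borel probability measure $\mu$ on $\mathbb{R}^d$ (the infinite convolution), and $\mu$ is a spectral measure with a spectrum in $\mathbb{Z}^d$: there is a countable set $\Lambda\subseteq\mathbb{Z}^d$ such that $\{e^{2\pi i\lambda\cdot x}:\lambda\in\Lambda\}$ is an orthonormal basis of $L^2(\mu)$. -/

import Mathlib

open MeasureTheory Filter Topology
open scoped BoundedContinuousFunction

noncomputable section

namespace InfConv

/-- `ℝ^d` with the Euclidean norm and the standard inner product. -/
abbrev Rd (d : ℕ) : Type := EuclideanSpace ℝ (Fin d)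

/-- The real matrix with the same entries as the integral matrix `R`. -/
def realMat {d : ℕ} (R : Matrix (Fin d) (Fin d) ℤ) : Matrix (Fin d) (Fin d) ℝ :=
  R.map (fun a : ℤ => (a : ℝ))

/-- The integral vector `k ∈ ℤ^d`, seen as a vector of `ℝ^d`. -/
def intVec {d : ℕ} (k : Fin d → ℤ) : Rd d :=
  WithLp.toLp 2 (fun i => (k i : ℝ))

/-- The lattice `ℤ^d` in `ℝ^d`. -/
def intLattice (d : ℕ) : Set (Rd d) := Set.range (intVec (d := d))

/-- The vector `R⁻¹ b ∈ ℝ^d`, for an integral matrix `R` and an integral vector `b`. -/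
def invApply {d : ℕ} (R : Matrix (Fin d) (Fin d) ℤ) (b : Fin d → ℤ) : Rd d :=
  WithLp.toLp 2 (Matrix.mulVec (realMat R)⁻¹ (fun i => (b i : ℝ)))

/-- The operator norm of the integral matrix `R` for the Euclidean norm of `ℝ^d`. -/
def opNorm {d : ℕ} (R : Matrix (Fin d) (Fin d) ℤ) : ℝ :=
  ‖Matrix.toEuclideanCLM (n := Fin d) (𝕜 := ℝ) (realMat R)‖

/-- `R` is expanding: all its (complex) eigenvalues have modulus `> 1`. -/
def IsExpanding {d : ℕ} (R : Matrix (Fin d) (Fin d) ℤ) : Prop :=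
  ∀ z ∈ spectrum ℂ (R.map (fun a : ℤ => (a : ℂ))), 1 < ‖z‖

/-- The matrix `[ (#B)^{-1/2} exp(-2πi (R⁻¹ b) · ℓ) ]`, `b ∈ B`, `ℓ ∈ L`. -/
def hadamardMatrix {d : ℕ} (R : Matrix (Fin d) (Fin d) ℤ) (B L : Finset (Fin d → ℤ)) :
    Matrix B L ℂ :=
  Matrix.of fun b l =>
    ((1 / Real.sqrt (B.card : ℝ) : ℝ) : ℂ) *
      Complex.exp (-(2 * (Real.pi : ℂ) * Complex.I *
        ((inner ℝ (invApply R b.1) (intVec l.1) : ℝ) : ℂ)))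

/-- `(R, B)` is an admissible pair in `ℝ^d`. -/
def IsAdmissiblePair {d : ℕ} (R : Matrix (Fin d) (Fin d) ℤ) (B : Finset (Fin d → ℤ)) : Prop :=
  IsExpanding R ∧
    ∃ L : Finset (Fin d → ℤ), L.card = B.card ∧
      hadamardMatrix R B L * (hadamardMatrix R B L).conjTranspose = 1 ∧
      (hadamardMatrix R B L).conjTranspose * hadamardMatrix R B L = 1

/-- The class `𝒟_d`: `R = diag(m_1, …, m_d)` with integers `m_i ≥ 2`, and `B` is a nonempty subset
of `∏ {0, …, m_i - 1}`. -/
def MemD {d : ℕ} (R : Matrix (Fin d) (Fin d) ℤ) (B : Finset (Fin d → ℤ)) : Prop :=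
  ∃ m : Fin d → ℤ, (∀ i, 2 ≤ m i) ∧ R = Matrix.diagonal m ∧
    B.Nonempty ∧ ∀ b ∈ B, ∀ i, 0 ≤ b i ∧ b i ≤ m i - 1

/-- The uniform discrete measure `δ_A = (#A)⁻¹ ∑_{a ∈ A} δ_a` on a finite set `A ⊆ ℝ^d`. -/
def unifMeasure {d : ℕ} (A : Finset (Rd d)) : Measure (Rd d) :=
  (A.card : ENNReal)⁻¹ • ∑ a ∈ A, Measure.dirac a

open Classical in
/-- The finite set `R⁻¹ B ⊆ ℝ^d`. -/
def invImage {d : ℕ} (R : Matrix (Fin d) (Fin d) ℤ) (B : Finset (Fin d → ℤ)) : Finset (Rd d) :=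
  B.image (invApply R)

/-- The product `R_{n-1} ⋯ R_1 R_0` of the first `n` terms of a sequence indexed from `0`. -/
def prodMat {d : ℕ} (R : ℕ → Matrix (Fin d) (Fin d) ℤ) : ℕ → Matrix (Fin d) (Fin d) ℤ
  | 0 => 1
  | n + 1 => R n * prodMat R n

/-- The `n`-fold convolution
`μ_n = δ_{R_0⁻¹ B_0} * δ_{(R_1 R_0)⁻¹ B_1} * ⋯ * δ_{(R_{n-1} ⋯ R_0)⁻¹ B_{n-1}}`
(the empty convolution `μ_0` is the Dirac measure at the origin). -/
def partialConv {d : ℕ} (R : ℕ → Matrix (Fin d) (Fin d) ℤ) (B : ℕ → Finset (Fin d → ℤ)) :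
    ℕ → Measure (Rd d)
  | 0 => Measure.dirac 0
  | n + 1 => (partialConv R B n).conv (unifMeasure (invImage (prodMat R (n + 1)) (B n)))

/-- `μ` is the infinite convolution of the sequence `(R_n, B_n)`: the measures `μ_n` converge
weakly to the Borel probability measure `μ`. -/
def IsInfiniteConvolution {d : ℕ} (R : ℕ → Matrix (Fin d) (Fin d) ℤ)
    (B : ℕ → Finset (Fin d → ℤ)) (μ : Measure (Rd d)) : Prop :=
  IsProbabilityMeasure μ ∧
    ∀ f : Rd d →ᵇ ℝ, Tendsto (fun n => ∫ x, f x ∂(partialConv R B n)) atTop (𝓝 (∫ x, f x ∂μ))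

/-- `Λ` is a spectrum of `μ`: `Λ` is countable and the exponentials `x ↦ exp(2πi λ · x)`, `λ ∈ Λ`,
form an orthonormal (Hilbert) basis of `L²(μ)`. -/
def IsSpectrum {d : ℕ} (μ : Measure (Rd d)) (Λ : Set (Rd d)) : Prop :=
  Λ.Countable ∧ ∃ e : HilbertBasis Λ ℂ (Lp ℂ 2 μ), ∀ l : Λ,
    (e l : Rd d → ℂ) =ᵐ[μ] fun x =>
      Complex.exp (2 * (Real.pi : ℂ) * Complex.I * ((inner ℝ l.1 x : ℝ) : ℂ))

end InfConv

end

/-! The limit measure μ is the law of a random series `pathSum` of independent uniform digits, with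
values in [0,1]^d. Its transform splits as `ft ω ξ = ftPart ω n ξ * ft (shift n ω) (scale (base ω n)
ξ)` (`ft_eq_mul`), and the finite factor is periodic under R_n⋯R_1 ℤ^d (`ftPart_add_base_mul`).

Integral exponentials are total in L²(μ) (`ae_eq_zero_of_integral_wave`). Indeed in each coordinate
one of the faces x_i = 0, x_i = 1 is null, so the projection to the torus is injective on a set of
full measure. Hence no `ft ω` vanishes on a whole coset ξ + ℤ^d: otherwise the unimodular function
`wave ξ` would be zero almost everywhere. A bound on the R_n leaves finitely many digit systems, so
the space of sequences is compact and this becomes a uniform lower bound ε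
(`exists_uniform_lower_bound`).

Admissibility gives finite spectra of the partial convolutions. By periodicity each of their points
may be moved by R_n⋯R_1 ℤ^d, and the lower bound chooses a move after which the tail transform is at
least ε. Points already chosen need no move once n is large, since their rescalings are near 0; so
the finite spectra can be nested (`exists_isGoodSpectrum_seq`). Let Λ be their union. Its
exponentials are orthonormal, and dominated convergence with constant ε⁻² gives ∑ ‖ft ω (ξ + λ)‖² =
1 (`tsum_norm_ft_sq`). This is equality in Bessel's inequality for every integral exponential, so
the closed span contains a total family (`isSpectrum_law`). -/

noncomputable section

namespace InfConv

variable {d : ℕ}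

section

/-! ### Exponentials and coordinatewise division -/

/-- The character `x ↦ exp(2πi ξ · x)`. -/
def wave (ξ x : Rd d) : ℂ :=
  Complex.exp (2 * (Real.pi : ℂ) * Complex.I * ((inner ℝ ξ x : ℝ) : ℂ))

lemma wave_eq (ξ x : Rd d) :
    wave ξ x = Complex.exp (((2 * Real.pi * inner ℝ ξ x : ℝ) : ℂ) * Complex.I) := by
  rw [wave]; congr 1; push_cast; ring

@[simp] lemma norm_wave (ξ x : Rd d) : ‖wave ξ x‖ = 1 := by
  rw [wave_eq, Complex.norm_exp_ofReal_mul_I]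

lemma wave_ne_zero (ξ x : Rd d) : wave ξ x ≠ 0 := Complex.exp_ne_zero _

lemma wave_comm (ξ x : Rd d) : wave ξ x = wave x ξ := by
  rw [wave, wave, real_inner_comm]

lemma wave_add_left (ξ η x : Rd d) : wave (ξ + η) x = wave ξ x * wave η x := by
  simp only [wave, ← Complex.exp_add, inner_add_left]; congr 1; push_cast; ring

lemma wave_add_right (ξ x y : Rd d) : wave ξ (x + y) = wave ξ x * wave ξ y := by
  rw [wave_comm, wave_add_left, wave_comm x, wave_comm y]

@[simp] lemma wave_zero_left (x : Rd d) : wave 0 x = 1 := by simp [wave]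

@[simp] lemma wave_zero_right (x : Rd d) : wave x 0 = 1 := by simp [wave]

lemma wave_neg_left (ξ x : Rd d) : wave (-ξ) x = (starRingEnd ℂ) (wave ξ x) := by
  rw [wave_eq, wave_eq, ← Complex.exp_conj]; congr 1
  simp only [inner_neg_left, map_mul, Complex.conj_ofReal, Complex.conj_I]; push_cast; ring

lemma wave_neg_right (ξ x : Rd d) : wave ξ (-x) = (starRingEnd ℂ) (wave ξ x) := by
  rw [wave_comm, wave_neg_left, wave_comm]

lemma wave_sum_right {ι : Type*} (ξ : Rd d) (s : Finset ι) (x : ι → Rd d) :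
    wave ξ (∑ i ∈ s, x i) = ∏ i ∈ s, wave ξ (x i) := by
  classical
  induction s using Finset.induction_on with
  | empty => simp
  | insert a s ha ih => rw [Finset.sum_insert ha, Finset.prod_insert ha, wave_add_right, ih]

lemma continuous_wave (ξ : Rd d) : Continuous (wave ξ) := by
  unfold wave; fun_prop

lemma norm_wave_sub_le (ξ x y : Rd d) :
    ‖wave ξ x - wave ξ y‖ ≤ 2 * Real.pi * ‖ξ‖ * ‖x - y‖ := by
  have h : wave ξ x - wave ξ y = wave ξ y * (wave ξ (x - y) - 1) := by
    rw [mul_sub, ← wave_add_right]; simp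
  rw [h, norm_mul, norm_wave, one_mul, wave_eq, mul_comm _ Complex.I]
  refine Real.norm_exp_I_mul_ofReal_sub_one_le.trans ?_
  rw [Real.norm_eq_abs, abs_mul, abs_of_pos Real.two_pi_pos, mul_assoc (2 * Real.pi)]
  gcongr
  exact abs_real_inner_le_norm _ _

lemma norm_wave_sub_le_left (ξ η x : Rd d) :
    ‖wave ξ x - wave η x‖ ≤ 2 * Real.pi * ‖x‖ * ‖ξ - η‖ := by
  rw [wave_comm ξ, wave_comm η]; exact norm_wave_sub_le _ _ _

lemma wave_intVec_intVec (k l : Fin d → ℤ) : wave (intVec k) (intVec l) = 1 := by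
  rw [wave, Complex.exp_eq_one_iff]
  refine ⟨∑ i, k i * l i, ?_⟩
  simp only [intVec, PiLp.inner_apply]
  simp
  rw [mul_comm]
  congr 1
  exact Finset.sum_congr rfl fun i _ => mul_comm _ _

@[simp] lemma intVec_apply (k : Fin d → ℤ) (i : Fin d) : intVec k i = k i := rfl

lemma intVec_add (k l : Fin d → ℤ) : intVec (k + l) = intVec k + intVec l := by
  ext i; simp

lemma intVec_sub (k l : Fin d → ℤ) : intVec (k - l) = intVec k - intVec l := by
  ext i; simp

@[simp] lemma intVec_zero : intVec (0 : Fin d → ℤ) = 0 := by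
  ext i; simp

lemma intVec_injective : Function.Injective (intVec (d := d)) := by
  intro k l h
  funext i
  have := congrArg (fun x : Rd d => x i) h
  simpa using this

/-- Coordinatewise division of `x` by the integral vector `p`. -/
def scale (p : Fin d → ℤ) (x : Rd d) : Rd d := WithLp.toLp 2 fun i => x i / p i

@[simp] lemma scale_apply (p : Fin d → ℤ) (x : Rd d) (i : Fin d) : scale p x i = x i / p i := rfl

lemma scale_add (p : Fin d → ℤ) (x y : Rd d) : scale p (x + y) = scale p x + scale p y := by
  ext i; simp [add_div]

lemma inner_scale (p : Fin d → ℤ) (x y : Rd d) :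
    inner ℝ x (scale p y) = inner ℝ (scale p x) y := by
  simp only [PiLp.inner_apply, scale_apply]
  refine Finset.sum_congr rfl fun i _ => ?_
  simp; ring

lemma wave_scale (p : Fin d → ℤ) (x y : Rd d) : wave x (scale p y) = wave (scale p x) y := by
  rw [wave, wave, inner_scale]

lemma scale_scale (p q : Fin d → ℤ) (x : Rd d) : scale p (scale q x) = scale (q * p) x := by
  ext i; simp [div_div]

lemma scale_mul_intVec {p : Fin d → ℤ} (hp : ∀ i, p i ≠ 0) (k : Fin d → ℤ) :
    scale p (intVec (p * k)) = intVec k := by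
  ext i
  have : (p i : ℝ) ≠ 0 := by exact_mod_cast hp i
  simp; field_simp

lemma norm_le_sqrt_mul {x : Rd d} {c : ℝ} (hc : 0 ≤ c) (h : ∀ i, |x i| ≤ c) :
    ‖x‖ ≤ √d * c := by
  rw [EuclideanSpace.norm_eq]
  apply Real.sqrt_le_iff.2 ⟨by positivity, ?_⟩
  rw [mul_pow, Real.sq_sqrt (Nat.cast_nonneg d)]
  calc ∑ i, ‖x i‖ ^ 2 ≤ ∑ _i : Fin d, c ^ 2 := by
        refine Finset.sum_le_sum fun i _ => ?_
        rw [Real.norm_eq_abs]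
        exact pow_le_pow_left₀ (abs_nonneg _) (h i) 2
    _ = d * c ^ 2 := by simp

/-! ### Sequences of digit systems -/

/-- A diagonal matrix `diag(m_1, …, m_d)` with `m_i ≥ 2`, together with a nonempty set of digits
in `∏ {0, …, m_i - 1}`. -/
structure DigitSystem (d : ℕ) where
  m : Fin d → ℤ
  B : Finset (Fin d → ℤ)
  two_le : ∀ i, 2 ≤ m i
  nonempty : B.Nonempty
  nonneg : ∀ b ∈ B, ∀ i, 0 ≤ b i
  le : ∀ b ∈ B, ∀ i, b i ≤ m i - 1

instance (D : DigitSystem d) : Nonempty D.B := D.nonempty.coe_sort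

/-- The diagonal of `R_{n-1} ⋯ R_0`. -/
def base (ω : ℕ → DigitSystem d) (n : ℕ) : Fin d → ℤ := ∏ k ∈ Finset.range n, (ω k).m

/-- The sequence without its first `n` terms. -/
def shift (n : ℕ) (ω : ℕ → DigitSystem d) : ℕ → DigitSystem d := fun k => ω (n + k)

variable (ω : ℕ → DigitSystem d)

@[simp] lemma base_zero : base ω 0 = 1 := by simp [base]

lemma base_succ (n : ℕ) : base ω (n + 1) = base ω n * (ω n).m := by
  simp [base, Finset.prod_range_succ]

lemma base_add (n k : ℕ) : base ω (n + k) = base ω n * base (shift n ω) k := by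
  simp [base, Finset.prod_range_add, shift]

lemma two_pow_le_base (n : ℕ) (i : Fin d) : (2 : ℝ) ^ n ≤ base ω n i := by
  induction n with
  | zero => simp
  | succ n ih =>
    rw [base_succ, pow_succ]
    have h : (2 : ℝ) ≤ (ω n).m i := by exact_mod_cast (ω n).two_le i
    have : (0 : ℝ) ≤ base ω n i := le_trans (by positivity) ih
    simp only [Pi.mul_apply, Int.cast_mul]
    gcongr

lemma base_pos (n : ℕ) (i : Fin d) : (0 : ℝ) < base ω n i :=
  lt_of_lt_of_le (by positivity) (two_pow_le_base ω n i)

lemma base_ne_zero (n : ℕ) (i : Fin d) : base ω n i ≠ 0 := by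
  have := base_pos ω n i
  exact_mod_cast this.ne'

lemma inv_base_le (n : ℕ) (i : Fin d) : 1 / (base ω n i : ℝ) ≤ (1 / 2) ^ n := by
  rw [one_div_pow]
  exact one_div_le_one_div_of_le (by positivity) (two_pow_le_base ω n i)

lemma norm_scale_base_le (n : ℕ) (x : Rd d) :
    ‖scale (base ω n) x‖ ≤ √d * ((1 / 2) ^ n * ‖x‖) := by
  refine norm_le_sqrt_mul (by positivity) fun i => ?_
  rw [scale_apply, abs_div, abs_of_pos (base_pos ω n i), div_eq_mul_one_div, mul_comm]
  gcongr
  · exact inv_base_le ω n i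
  · exact PiLp.norm_apply_le x i

/-- Sequences of digits. -/
abbrev Path (ω : ℕ → DigitSystem d) : Type := ∀ k, (ω k).B

/-- The `k`-th term of the random series. -/
def term (k : ℕ) (b : Fin d → ℤ) : Rd d := scale (base ω (k + 1)) (intVec b)

/-- The partial sums of the random series. -/
def partialSum (N : ℕ) (b : Path ω) : Rd d := ∑ k ∈ Finset.range N, term ω k (b k)

/-- The sum of the random series. -/
def pathSum (b : Path ω) : Rd d :=
  WithLp.toLp 2 fun i => ∑' k, ((b k : Fin d → ℤ) i : ℝ) / base ω (k + 1) i

lemma partialSum_apply (N : ℕ) (b : Path ω) (i : Fin d) :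
    partialSum ω N b i =
      ∑ k ∈ Finset.range N, ((b k : Fin d → ℤ) i : ℝ) / base ω (k + 1) i := by
  simp [partialSum, term]

/-- The sum telescopes, since (m − 1)/(p m) = 1/p − 1/(p m). It gives the exact size of the tail
left to the largest digits. -/
lemma sum_max_digits (N : ℕ) (i : Fin d) :
    ∑ k ∈ Finset.range N, (((ω k).m i : ℝ) - 1) / base ω (k + 1) i = 1 - 1 / base ω N i := by
  induction N with
  | zero => simp
  | succ N ih =>
    rw [Finset.sum_range_succ, ih]
    have h1 := (base_pos ω N i).ne'
    have h2 : ((ω N).m i : ℝ) ≠ 0 := by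
      have := (ω N).two_le i
      exact_mod_cast (by omega : (ω N).m i ≠ 0)
    simp only [base_succ, Pi.mul_apply, Int.cast_mul]
    field_simp
    ring

lemma hasSum_max_digits (i : Fin d) :
    HasSum (fun k => (((ω k).m i : ℝ) - 1) / base ω (k + 1) i) 1 := by
  rw [hasSum_iff_tendsto_nat_of_nonneg]
  · simp_rw [sum_max_digits]
    have : Tendsto (fun n => 1 / (base ω n i : ℝ)) atTop (𝓝 0) :=
      squeeze_zero (fun n => (one_div_pos.2 (base_pos ω n i)).le) (fun n => inv_base_le ω n i)
        (tendsto_pow_atTop_nhds_zero_of_lt_one (by norm_num) (by norm_num))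
    simpa using this.const_sub 1
  · intro k
    have : (2 : ℝ) ≤ (ω k).m i := by exact_mod_cast (ω k).two_le i
    exact div_nonneg (by linarith) (base_pos ω _ i).le

lemma digit_nonneg (b : Path ω) (i : Fin d) (k : ℕ) :
    0 ≤ ((b k : Fin d → ℤ) i : ℝ) / base ω (k + 1) i :=
  div_nonneg (by exact_mod_cast (ω k).nonneg _ (b k).2 i) (base_pos ω _ i).le

lemma digit_le (b : Path ω) (i : Fin d) (k : ℕ) :
    ((b k : Fin d → ℤ) i : ℝ) / base ω (k + 1) i ≤ (((ω k).m i : ℝ) - 1) / base ω (k + 1) i := by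
  have := (base_pos ω (k + 1) i).le
  gcongr
  exact_mod_cast (ω k).le _ (b k).2 i

lemma hasSum_pathSum (b : Path ω) (i : Fin d) :
    HasSum (fun k => ((b k : Fin d → ℤ) i : ℝ) / base ω (k + 1) i) (pathSum ω b i) :=
  (Summable.of_nonneg_of_le (digit_nonneg ω b i) (digit_le ω b i)
    (hasSum_max_digits ω i).summable).hasSum

lemma partialSum_le_pathSum (N : ℕ) (b : Path ω) (i : Fin d) :
    partialSum ω N b i ≤ pathSum ω b i := by
  rw [partialSum_apply]
  exact sum_le_hasSum _ (fun k _ => digit_nonneg ω b i k) (hasSum_pathSum ω b i)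

lemma hasSum_one_sub_pathSum (b : Path ω) (i : Fin d) :
    HasSum (fun k => (((ω k).m i : ℝ) - 1) / base ω (k + 1) i -
      ((b k : Fin d → ℤ) i : ℝ) / base ω (k + 1) i) (1 - pathSum ω b i) :=
  (hasSum_max_digits ω i).sub (hasSum_pathSum ω b i)

lemma pathSum_le_partialSum_add (N : ℕ) (b : Path ω) (i : Fin d) :
    pathSum ω b i ≤ partialSum ω N b i + 1 / base ω N i := by
  have := sum_le_hasSum (Finset.range N) (fun k _ => sub_nonneg.2 (digit_le ω b i k))
    (hasSum_one_sub_pathSum ω b i)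
  rw [Finset.sum_sub_distrib, sum_max_digits, ← partialSum_apply] at this
  linarith

lemma norm_partialSum_sub_pathSum_le (N : ℕ) (b : Path ω) :
    ‖partialSum ω N b - pathSum ω b‖ ≤ √d * (1 / 2) ^ N := by
  refine norm_le_sqrt_mul (by positivity) fun i => ?_
  have h1 := partialSum_le_pathSum ω N b i
  have h2 := pathSum_le_partialSum_add ω N b i
  have h3 := inv_base_le ω N i
  rw [PiLp.sub_apply, abs_le]
  constructor <;> linarith [show (0 : ℝ) ≤ (1 / 2) ^ N by positivity]

lemma tendsto_partialSum (b : Path ω) :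
    Tendsto (fun N => partialSum ω N b) atTop (𝓝 (pathSum ω b)) := by
  rw [tendsto_iff_norm_sub_tendsto_zero]
  refine squeeze_zero (fun _ => norm_nonneg _) (fun N => norm_partialSum_sub_pathSum_le ω N b) ?_
  simpa using (tendsto_pow_atTop_nhds_zero_of_lt_one (by norm_num : (0 : ℝ) ≤ 1 / 2)
    (by norm_num)).const_mul (√d)

lemma pathSum_nonneg (b : Path ω) (i : Fin d) : 0 ≤ pathSum ω b i := by
  simpa [partialSum] using partialSum_le_pathSum ω 0 b i

lemma pathSum_le_one (b : Path ω) (i : Fin d) : pathSum ω b i ≤ 1 := by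
  simpa [partialSum] using pathSum_le_partialSum_add ω 0 b i

lemma norm_pathSum_le (b : Path ω) : ‖pathSum ω b‖ ≤ √d := by
  simpa [partialSum] using norm_partialSum_sub_pathSum_le ω 0 b

lemma digit_eq_zero_of_pathSum_eq_zero {b : Path ω} {i : Fin d} (h : pathSum ω b i = 0) (k : ℕ) :
    (b k : Fin d → ℤ) i = 0 := by
  have := hasSum_pathSum ω b i
  rw [h, hasSum_zero_iff_of_nonneg (digit_nonneg ω b i)] at this
  have := congrFun this k
  simpa [(base_pos ω (k + 1) i).ne', base_ne_zero] using this

lemma digit_eq_max_of_pathSum_eq_one {b : Path ω} {i : Fin d} (h : pathSum ω b i = 1) (k : ℕ) :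
    (b k : Fin d → ℤ) i = (ω k).m i - 1 := by
  have := hasSum_one_sub_pathSum ω b i
  rw [h, sub_self, hasSum_zero_iff_of_nonneg (fun k => sub_nonneg.2 (digit_le ω b i k))] at this
  have := congrFun this k
  rw [← sub_div] at this
  simp [base_ne_zero] at this
  have h' : ((b k : Fin d → ℤ) i : ℝ) = (((ω k).m i - 1 : ℤ) : ℝ) := by push_cast; linarith
  exact_mod_cast h'

end

section

/-! ### The law of the random series -/

/-- The uniform probability measure on the digits. -/
def uniform (D : DigitSystem d) : Measure D.B :=
  (D.B.card : ENNReal)⁻¹ • ∑ b : D.B, Measure.dirac b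

lemma card_ne_zero (D : DigitSystem d) : (D.B.card : ENNReal) ≠ 0 := by
  simpa using D.nonempty.ne_empty

instance (D : DigitSystem d) : IsProbabilityMeasure (uniform D) := by
  constructor
  simp [uniform, ENNReal.inv_mul_cancel (card_ne_zero D) (ENNReal.natCast_ne_top _)]

lemma integral_uniform (D : DigitSystem d) (f : (Fin d → ℤ) → ℂ) :
    ∫ b, f b ∂(uniform D) = (D.B.card : ℂ)⁻¹ * ∑ b ∈ D.B, f b := by
  rw [uniform, integral_smul_measure, integral_finsetSum_measure fun _ _ =>
    integrable_dirac (by simp)]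
  simp only [integral_dirac, ENNReal.toReal_inv, ENNReal.toReal_natCast]
  rw [Complex.real_smul, Finset.sum_coe_sort D.B f]
  simp

lemma uniform_apply (D : DigitSystem d) (p : (Fin d → ℤ) → Prop) [DecidablePred p] :
    uniform D {b | p b} = ((D.B.filter p).card : ENNReal) / D.B.card := by
  rw [uniform, Measure.smul_apply, Measure.finsetSum_apply, smul_eq_mul, ENNReal.div_eq_inv_mul]
  congr 1
  simp only [Measure.dirac_apply, Set.indicator_apply, Set.mem_ofPred_eq, Pi.one_apply]
  rw [Finset.sum_coe_sort D.B (fun b => if p b then (1 : ENNReal) else 0), Finset.sum_boole]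

/-- The measure on sequences of independent, uniformly distributed digits. -/
def pathMeasure (ω : ℕ → DigitSystem d) : Measure (Path ω) :=
  Measure.infinitePi fun k => uniform (ω k)

instance (ω : ℕ → DigitSystem d) : IsProbabilityMeasure (pathMeasure ω) := by
  unfold pathMeasure; infer_instance

variable (ω : ℕ → DigitSystem d)

lemma measurable_digit (k : ℕ) {α : Type*} [MeasurableSpace α] (f : (Fin d → ℤ) → α) :
    Measurable fun b : Path ω => f (b k) :=
  (measurable_of_countable fun b : (ω k).B => f b).comp (measurable_pi_apply k)

lemma measurable_partialSum (N : ℕ) : Measurable (partialSum ω N) :=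
  Finset.measurable_fun_sum _ fun k _ => measurable_digit ω k (term ω k)

lemma measurable_pathSum : Measurable (pathSum ω) :=
  measurable_of_tendsto_metrizable (measurable_partialSum ω)
    (tendsto_pi_nhds.2 (tendsto_partialSum ω))

/-- The infinite convolution attached to `ω`. -/
def law : Measure (Rd d) := (pathMeasure ω).map (pathSum ω)

instance : IsProbabilityMeasure (law ω) :=
  Measure.isProbabilityMeasure_map (measurable_pathSum ω).aemeasurable

lemma iIndepFun_digit {α : Type*} [MeasurableSpace α] (f : ∀ _ : ℕ, (Fin d → ℤ) → α) :
    ProbabilityTheory.iIndepFun (fun k (b : Path ω) => f k (b k)) (pathMeasure ω) :=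
  ProbabilityTheory.iIndepFun_infinitePi (X := fun k (b : (ω k).B) => f k b)
    fun _ => measurable_of_countable _

lemma map_digit (k : ℕ) {α : Type*} [MeasurableSpace α] (f : (Fin d → ℤ) → α) :
    (pathMeasure ω).map (fun b => f (b k)) =
      ((ω k).B.card : ENNReal)⁻¹ • ∑ b ∈ (ω k).B, Measure.dirac (f b) := by
  have h : Measurable fun b : (ω k).B => f b := measurable_of_countable _
  rw [show (fun b : Path ω => f (b k)) = (fun b : (ω k).B => f b) ∘ fun b => b k from rfl,
    ← Measure.map_map h (measurable_pi_apply k), pathMeasure, Measure.infinitePi_map_eval, uniform,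
    Measure.map_smul, ← Finset.sum_coe_sort (ω k).B (fun b => Measure.dirac (f b))]
  congr 1
  rw [← Measure.mapₗ_apply_of_measurable h, map_sum]
  simp [Measure.mapₗ_apply_of_measurable h, Measure.map_dirac' h]

/-! ### Fourier transforms -/

/-- The Fourier transform (up to sign) of the infinite convolution. -/
def ft (ξ : Rd d) : ℂ := ∫ x, wave ξ x ∂(law ω)

/-- The Fourier transform (up to sign) of `δ_{R⁻¹B}`. -/
def mask (D : DigitSystem d) (ξ : Rd d) : ℂ :=
  (D.B.card : ℂ)⁻¹ * ∑ b ∈ D.B, wave ξ (scale D.m (intVec b))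

/-- The Fourier transform (up to sign) of the law of a partial sum. -/
def ftPart (n : ℕ) (ξ : Rd d) : ℂ :=
  ∏ k ∈ Finset.range n, mask (ω k) (scale (base ω k) ξ)

lemma integrable_wave {α : Type*} [MeasurableSpace α] (μ : Measure α) [IsFiniteMeasure μ]
    {X : α → Rd d} (hX : Measurable X) (ξ : Rd d) : Integrable (fun a => wave ξ (X a)) μ :=
  Integrable.of_bound ((continuous_wave ξ).measurable.comp hX).aestronglyMeasurable 1
    (by simp)

lemma ft_eq (ξ : Rd d) : ft ω ξ = ∫ b, wave ξ (pathSum ω b) ∂(pathMeasure ω) := by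
  rw [ft, law, integral_map (measurable_pathSum ω).aemeasurable
    (continuous_wave ξ).aestronglyMeasurable]

@[simp] lemma ft_zero : ft ω 0 = 1 := by simp [ft]

lemma integral_wave_term (k : ℕ) (ξ : Rd d) :
    ∫ b, wave ξ (term ω k (b k)) ∂(pathMeasure ω) = mask (ω k) (scale (base ω k) ξ) := by
  have h := integral_uniform (ω k) fun b => wave ξ (term ω k b)
  rw [← Measure.infinitePi_map_eval (fun k => uniform (ω k)) k, integral_map
    (measurable_pi_apply k).aemeasurable (measurable_of_countable _).aestronglyMeasurable] at h
  rw [pathMeasure, h, mask]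
  congr 1
  refine Finset.sum_congr rfl fun b _ => ?_
  rw [term, wave_scale, wave_scale, scale_scale, base_succ]

lemma integral_wave_partialSum (N : ℕ) (ξ : Rd d) :
    ∫ b, wave ξ (partialSum ω N b) ∂(pathMeasure ω) = ftPart ω N ξ := by
  have h := (iIndepFun_digit ω fun k b => wave ξ (term ω k b)).precomp
    (g := fun i : Finset.range N => (i : ℕ)) Subtype.val_injective
  have := h.integral_fun_prod_eq_prod_integral fun i =>
    (measurable_digit ω i (fun b => wave ξ (term ω i b))).aestronglyMeasurable
  simp only [partialSum, wave_sum_right, ftPart, ← integral_wave_term]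
  rw [← Finset.prod_coe_sort (Finset.range N)
    (fun k => ∫ b, wave ξ (term ω k (b k)) ∂(pathMeasure ω)), ← this]
  congr 1
  funext b
  exact (Finset.prod_coe_sort (Finset.range N) (fun k => wave ξ (term ω k (b k)))).symm

lemma norm_ftPart_sub_ft_le (N : ℕ) (ξ : Rd d) :
    ‖ftPart ω N ξ - ft ω ξ‖ ≤ 2 * Real.pi * ‖ξ‖ * (√d * (1 / 2) ^ N) := by
  rw [← integral_wave_partialSum, ft_eq, ← integral_sub
    (integrable_wave _ (measurable_partialSum ω N) ξ) (integrable_wave _ (measurable_pathSum ω) ξ)]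
  refine (norm_integral_le_of_norm_le_const (C := 2 * Real.pi * ‖ξ‖ * (√d * (1 / 2) ^ N))
    (Eventually.of_forall fun b => ?_)).trans (by simp)
  refine (norm_wave_sub_le _ _ _).trans ?_
  gcongr
  exact norm_partialSum_sub_pathSum_le ω N b

/-- The Lipschitz constant is independent of `ω` because every series lies in [0,1]^d; the
compactness argument needs this uniformity. -/
lemma norm_ft_sub_le (ξ η : Rd d) : ‖ft ω ξ - ft ω η‖ ≤ 2 * Real.pi * √d * ‖ξ - η‖ := by
  rw [ft_eq, ft_eq, ← integral_sub
    (integrable_wave _ (measurable_pathSum ω) ξ) (integrable_wave _ (measurable_pathSum ω) η)]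
  refine (norm_integral_le_of_norm_le_const (C := 2 * Real.pi * √d * ‖ξ - η‖)
    (Eventually.of_forall fun b => ?_)).trans (by simp)
  refine (norm_wave_sub_le_left _ _ _).trans ?_
  gcongr
  exact norm_pathSum_le ω b

lemma tendsto_ftPart (ξ : Rd d) : Tendsto (fun N => ftPart ω N ξ) atTop (𝓝 (ft ω ξ)) := by
  rw [tendsto_iff_norm_sub_tendsto_zero]
  refine squeeze_zero (fun _ => norm_nonneg _) (fun N => norm_ftPart_sub_ft_le ω N ξ) ?_
  simpa using ((tendsto_pow_atTop_nhds_zero_of_lt_one (by norm_num : (0 : ℝ) ≤ 1 / 2)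
    (by norm_num)).const_mul (√d)).const_mul (2 * Real.pi * ‖ξ‖)

lemma ftPart_add (n N : ℕ) (ξ : Rd d) :
    ftPart ω (n + N) ξ = ftPart ω n ξ * ftPart (shift n ω) N (scale (base ω n) ξ) := by
  simp only [ftPart, Finset.prod_range_add, scale_scale, base_add]
  rfl

/-- After the first n digits, the rest of the series is a rescaled copy of the series of the shifted
sequence. -/
lemma ft_eq_mul (n : ℕ) (ξ : Rd d) :
    ft ω ξ = ftPart ω n ξ * ft (shift n ω) (scale (base ω n) ξ) := by
  refine tendsto_nhds_unique
    ((tendsto_add_atTop_iff_nat n).2 (tendsto_ftPart ω ξ)) ?_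
  simp_rw [fun N => add_comm N n, ftPart_add]
  exact (tendsto_ftPart _ _).const_mul _

lemma mask_add_mul (D : DigitSystem d) (ξ : Rd d) (k : Fin d → ℤ) :
    mask D (ξ + intVec (D.m * k)) = mask D ξ := by
  have h : ∀ i, D.m i ≠ 0 := fun i => by have := D.two_le i; omega
  rw [mask, mask]
  congr 1
  refine Finset.sum_congr rfl fun b _ => ?_
  rw [wave_add_left, wave_scale _ (intVec _), scale_mul_intVec h, wave_intVec_intVec, mul_one]

lemma ftPart_add_base_mul (n : ℕ) (ξ : Rd d) (k : Fin d → ℤ) :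
    ftPart ω n (ξ + intVec (base ω n * k)) = ftPart ω n ξ := by
  refine Finset.prod_congr rfl fun j hj => ?_
  obtain ⟨r, rfl⟩ := Nat.exists_eq_add_of_lt (Finset.mem_range.1 hj)
  -- Division by `base ω j` leaves a shift by a multiple of `(ω j).m`, which is a period of the
  -- `j`-th mask.
  rw [scale_add, show base ω (j + r + 1) * k =
      base ω j * ((ω j).m * (base (shift (j + 1) ω) r * k)) by
    rw [show j + r + 1 = (j + 1) + r by ring, base_add, base_succ]; ring,
    scale_mul_intVec (base_ne_zero ω j), mask_add_mul]

/-! ### Weak convergence of the partial convolutions -/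

lemma invApply_diagonal {p : Fin d → ℤ} (hp : ∀ i, p i ≠ 0) (b : Fin d → ℤ) :
    invApply (Matrix.diagonal p) b = scale p (intVec b) := by
  have h : (realMat (Matrix.diagonal p))⁻¹ = Matrix.diagonal fun i => ((p i : ℝ))⁻¹ := by
    refine Matrix.inv_eq_right_inv ?_
    rw [realMat, Matrix.diagonal_map (by simp), Matrix.diagonal_mul_diagonal,
      ← Matrix.diagonal_one]
    congr 1
    funext i
    exact mul_inv_cancel₀ (by exact_mod_cast hp i)
  ext i
  rw [invApply, h]
  simp [Matrix.mulVec_diagonal, div_eq_inv_mul]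

lemma scale_intVec_injective {p : Fin d → ℤ} (hp : ∀ i, p i ≠ 0) :
    Function.Injective fun b => scale p (intVec b) := by
  intro b c h
  funext i
  have h' := congrArg (fun x : Rd d => x i) h
  have hi : (p i : ℝ) ≠ 0 := by exact_mod_cast hp i
  simp only [scale_apply, intVec_apply] at h'
  rw [div_left_inj' hi] at h'
  exact_mod_cast h'

variable {ω} {R : ℕ → Matrix (Fin d) (Fin d) ℤ} {B : ℕ → Finset (Fin d → ℤ)}

lemma prodMat_eq_diagonal (hR : ∀ n, R n = Matrix.diagonal (ω n).m) (n : ℕ) :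
    prodMat R n = Matrix.diagonal (base ω n) := by
  induction n with
  | zero => simp [prodMat]
  | succ n ih =>
    rw [prodMat, ih, hR, Matrix.diagonal_mul_diagonal, base_succ]
    congr 1
    funext i
    exact mul_comm _ _

lemma partialConv_eq_map (hR : ∀ n, R n = Matrix.diagonal (ω n).m) (hB : ∀ n, B n = (ω n).B)
    (n : ℕ) : partialConv R B n = (pathMeasure ω).map (partialSum ω n) := by
  classical
  induction n with
  | zero =>
    rw [partialConv]
    have : partialSum ω 0 = fun _ => 0 := by funext b; simp [partialSum]
    rw [this, Measure.map_const]; simp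
  | succ n ih =>
    have hterm : unifMeasure (invImage (prodMat R (n + 1)) (B n)) =
        (pathMeasure ω).map fun b => term ω n (b n) := by
      have hinv : invApply (prodMat R (n + 1)) = term ω n := by
        funext b
        rw [prodMat_eq_diagonal hR, invApply_diagonal (base_ne_zero ω _), term]
      -- Injectivity keeps the image from having fewer points than `B n`, so the normalizing factors
      -- agree.
      have hinj : Function.Injective (term ω n) :=
        scale_intVec_injective (base_ne_zero ω (n + 1))
      have himage : invImage (prodMat R (n + 1)) (ω n).B = (ω n).B.map ⟨term ω n, hinj⟩ := by
        ext x; simp [invImage, hinv]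
      rw [map_digit, unifMeasure, hB, himage, Finset.card_map, Finset.sum_map]
      rfl
    have hsum : partialSum ω (n + 1) = partialSum ω n + fun b => term ω n (b n) := by
      funext b; simp [partialSum, Finset.sum_range_succ]
    have hind : ProbabilityTheory.IndepFun (partialSum ω n) (fun b => term ω n (b n))
        (pathMeasure ω) := by
      have := (iIndepFun_digit ω fun k => term ω k).indepFun_finsetSum_of_notMem
        (fun k => measurable_digit ω k _) (s := Finset.range n) (i := n) (by simp)
      convert this using 1
      funext b; simp [partialSum]
    rw [partialConv, ih, hterm, hsum, hind.map_add_eq_map_conv_map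
      (measurable_partialSum ω n) (measurable_digit ω n _)]

lemma isInfiniteConvolution_law (hR : ∀ n, R n = Matrix.diagonal (ω n).m)
    (hB : ∀ n, B n = (ω n).B) : IsInfiniteConvolution R B (law ω) := by
  refine ⟨inferInstance, fun f => ?_⟩
  simp_rw [partialConv_eq_map hR hB, law]
  rw [integral_map (measurable_pathSum ω).aemeasurable f.continuous.aestronglyMeasurable]
  simp_rw [fun n => integral_map (measurable_partialSum ω n).aemeasurable
    (f.continuous.aestronglyMeasurable (μ := (pathMeasure ω).map (partialSum ω n)))]
  refine tendsto_integral_of_dominated_convergence (fun _ => ‖f‖)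
    (fun n => (f.continuous.measurable.comp (measurable_partialSum ω n)).aestronglyMeasurable)
    (integrable_const _) (fun n => Eventually.of_forall fun b => f.norm_coe_le_norm _)
    (Eventually.of_forall fun b => ?_)
  exact (f.continuous.tendsto _).comp (tendsto_partialSum ω b)

end

section

variable (ω : ℕ → DigitSystem d)

/-! ### Integral exponentials are total in `L²` of the infinite convolution -/

lemma pathMeasure_forall_digit_le (N : ℕ) (p : ℕ → (Fin d → ℤ) → Prop) [∀ k, DecidablePred (p k)] :
    pathMeasure ω {b | ∀ k, p k (b k)} ≤
      ∏ k ∈ Finset.range N, (((ω k).B.filter (p k)).card : ENNReal) / (ω k).B.card := by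
  have h : {b : Path ω | ∀ k, p k (b k)} ⊆
      Set.pi (Finset.range N : Set ℕ) fun k => {b : (ω k).B | p k b} := fun b hb k _ => hb k
  refine (measure_mono h).trans ?_
  rw [pathMeasure, Measure.infinitePi_pi _ fun k _ => (Set.to_countable _).measurableSet]
  simp_rw [uniform_apply]
  rfl

lemma div_card_mul_div_card_le (D : DigitSystem d) (i : Fin d) :
    (((D.B.filter fun b => b i = 0).card : ENNReal) / D.B.card) *
      (((D.B.filter fun b => b i = D.m i - 1).card : ENNReal) / D.B.card) ≤ 1 / 4 := by
  set x := (D.B.filter fun b => b i = 0).card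
  set y := (D.B.filter fun b => b i = D.m i - 1).card
  set n := D.B.card with hn
  have hdisj : Disjoint (D.B.filter fun b => b i = 0) (D.B.filter fun b => b i = D.m i - 1) := by
    rw [Finset.disjoint_filter]
    intro b _ h1 h2
    have := D.two_le i
    omega
  have hxy : x + y ≤ n := by
    rw [← Finset.card_union_of_disjoint hdisj]
    exact Finset.card_le_card (Finset.union_subset (Finset.filter_subset _ _)
      (Finset.filter_subset _ _))
  have hn0 : 0 < n := D.nonempty.card_pos
  have h4 : 4 * (x * y) ≤ n * n := by nlinarith [sq_nonneg ((x : ℤ) - y), sq_nonneg (x - y)]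
  have hn' : (n : ENNReal) ≠ 0 := by exact_mod_cast hn0.ne'
  rw [← ENNReal.mul_div_mul_comm (Or.inl hn') (Or.inl (ENNReal.natCast_ne_top _))]
  refine ENNReal.div_le_of_le_mul ?_
  rw [one_div, ← ENNReal.div_eq_inv_mul, ENNReal.le_div_iff_mul_le (by simp) (by simp)]
  rw [mul_comm]
  exact_mod_cast h4

/-- Being on a face forces every i-th digit to be extreme: all 0, or all m − 1. These two digit sets
are disjoint as m ≥ 2, so at each step their probabilities have product at most 1/4. -/
lemma pathMeasure_face (i : Fin d) :
    pathMeasure ω {b | pathSum ω b i = 0} = 0 ∨ pathMeasure ω {b | pathSum ω b i = 1} = 0 := by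
  rw [← mul_eq_zero, ← nonpos_iff_eq_zero]
  have h : ∀ N : ℕ, pathMeasure ω {b | pathSum ω b i = 0} *
      pathMeasure ω {b | pathSum ω b i = 1} ≤ (1 / 4) ^ N := fun N => by
    calc _ ≤ pathMeasure ω {b | ∀ k, (b k : Fin d → ℤ) i = 0} *
        pathMeasure ω {b | ∀ k, (b k : Fin d → ℤ) i = (ω k).m i - 1} := by
          exact mul_le_mul'
            (measure_mono fun b hb k => digit_eq_zero_of_pathSum_eq_zero ω hb k)
            (measure_mono fun b hb k => digit_eq_max_of_pathSum_eq_one ω hb k)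
      _ ≤ _ := mul_le_mul' (pathMeasure_forall_digit_le ω N fun _ b => b i = 0)
          (pathMeasure_forall_digit_le ω N fun k b => b i = (ω k).m i - 1)
      _ ≤ _ := by
          rw [← Finset.prod_mul_distrib]
          refine (Finset.prod_le_prod' fun k _ => div_card_mul_div_card_le (ω k) i).trans ?_
          simp
  refine ge_of_tendsto' (ENNReal.tendsto_pow_atTop_nhds_zero_of_lt_one ?_) h
  rw [one_div, ENNReal.inv_lt_one]; norm_num

/-- The projection of `ℝ^d` onto the torus. -/
def toTorus (x : Rd d) : UnitAddTorus (Fin d) := fun i => (x i : UnitAddCircle)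

lemma measurable_toTorus : Measurable (toTorus (d := d)) :=
  measurable_pi_lambda _ fun i => AddCircle.measurable_mk'.comp (by fun_prop)

lemma wave_intVec_eq_mFourier (k : Fin d → ℤ) (x : Rd d) :
    wave (intVec k) x = UnitAddTorus.mFourier k (toTorus x) := by
  simp only [UnitAddTorus.mFourier, toTorus, ContinuousMap.coe_mk, fourier_coe_apply,
    ← Complex.exp_sum, wave]
  congr 1
  simp only [PiLp.inner_apply, intVec_apply]
  push_cast
  rw [Finset.mul_sum]
  refine Finset.sum_congr rfl fun i _ => ?_
  simp
  ring

/-- The infinite convolution lives on a set on which the projection to the torus is injective. -/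
lemma exists_section : ∃ s : UnitAddTorus (Fin d) → Rd d, Measurable s ∧
    ∀ᵐ x ∂(law ω), s (toTorus x) = x := by
  classical
  -- In each coordinate the representative of a class is taken in (0,1] if the face 0 is null, and
  -- in [0,1) otherwise; in the second case the face 1 is null.
  let e : Fin d → UnitAddCircle → ℝ := fun i =>
    if pathMeasure ω {b | pathSum ω b i = 0} = 0 then
      fun t => (AddCircle.measurableEquivIoc (1 : ℝ) 0 t : ℝ)
    else fun t => (AddCircle.measurableEquivIco (1 : ℝ) 0 t : ℝ)
  have he : ∀ i, Measurable (e i) := fun i => by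
    by_cases h : pathMeasure ω {b | pathSum ω b i = 0} = 0
    · simp only [e, if_pos h]
      exact measurable_subtype_coe.comp (MeasurableEquiv.measurable _)
    · simp only [e, if_neg h]
      exact measurable_subtype_coe.comp (MeasurableEquiv.measurable _)
  have hs : Measurable fun t : UnitAddTorus (Fin d) => (WithLp.toLp 2 fun i => e i (t i) : Rd d) :=
    (PiLp.continuous_toLp 2 _).measurable.comp
      (measurable_pi_lambda _ fun i => (he i).comp (measurable_pi_apply i))
  refine ⟨_, hs, ?_⟩
  refine (ae_map_iff (measurable_pathSum ω).aemeasurable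
    (measurableSet_eq_fun (hs.comp measurable_toTorus) measurable_id)).2 ?_
  have hcoord : ∀ᵐ b ∂(pathMeasure ω), ∀ i,
      e i ((pathSum ω b i : ℝ) : UnitAddCircle) = pathSum ω b i := by
    refine ae_all_iff.2 fun i => ?_
    by_cases h : pathMeasure ω {b | pathSum ω b i = 0} = 0
    · have h' : ∀ᵐ b ∂(pathMeasure ω), pathSum ω b i ≠ 0 := by
        rw [ae_iff]; simpa using h
      filter_upwards [h'] with b hb
      simp only [e, if_pos h]
      exact AddCircle.equivIoc_coe_of_mem (p := (1 : ℝ)) (a := 0)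
        ⟨lt_of_le_of_ne (pathSum_nonneg ω b i) hb.symm, by simpa using pathSum_le_one ω b i⟩
    · have h' : ∀ᵐ b ∂(pathMeasure ω), pathSum ω b i ≠ 1 := by
        rw [ae_iff]; simpa using (pathMeasure_face ω i).resolve_left h
      filter_upwards [h'] with b hb
      simp only [e, if_neg h]
      exact AddCircle.equivIco_coe_of_mem (p := (1 : ℝ)) (a := 0)
        ⟨pathSum_nonneg ω b i, by simpa using lt_of_le_of_ne (pathSum_le_one ω b i) hb⟩
  filter_upwards [hcoord] with b hb
  ext i
  exact hb i

/-- Trigonometric polynomials are uniformly dense in the continuous functions on the torus, and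
these are dense in L² of any finite measure. -/
lemma ae_eq_zero_of_torus (m : Measure (UnitAddTorus (Fin d))) [IsFiniteMeasure m]
    {g : UnitAddTorus (Fin d) → ℂ} (hg : MemLp g 2 m)
    (h : ∀ k, ∫ t, UnitAddTorus.mFourier k t * g t ∂m = 0) : g =ᵐ[m] 0 := by
  let T : C(UnitAddTorus (Fin d), ℂ) →L[ℂ] Lp ℂ 2 m := ContinuousMap.toLp 2 m ℂ
  have hT : ∀ F, inner ℂ (T F) (hg.toLp g) = ∫ t, (starRingEnd ℂ) (F t) * g t ∂m := fun F => by
    rw [L2.inner_def]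
    refine integral_congr_ae ?_
    filter_upwards [ContinuousMap.coeFn_toLp (p := 2) (𝕜 := ℂ) m F, hg.coeFn_toLp] with t h1 h2
    rw [h1, h2, RCLike.inner_apply, mul_comm]
  have hclosed : IsClosed {F : C(UnitAddTorus (Fin d), ℂ) | inner ℂ (T F) (hg.toLp g) = 0} :=
    isClosed_eq (by fun_prop) continuous_const
  have hspan : ∀ F ∈ Submodule.span ℂ (Set.range (UnitAddTorus.mFourier (d := Fin d))),
      inner ℂ (T F) (hg.toLp g) = 0 := fun F hF => by
    induction hF using Submodule.span_induction with
    | mem x hx =>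
      obtain ⟨k, rfl⟩ := hx
      rw [hT, ← h (-k)]
      simp_rw [UnitAddTorus.mFourier_neg]
    | zero => simp
    | add x y _ _ hx hy => rw [map_add, inner_add_left, hx, hy, add_zero]
    | smul c x _ hx => rw [map_smul, inner_smul_left, hx, mul_zero]
  have hall : ∀ F, inner ℂ (T F) (hg.toLp g) = 0 := fun F => by
    have : F ∈ (Submodule.span ℂ (Set.range
        (UnitAddTorus.mFourier (d := Fin d)))).topologicalClosure := by
      rw [UnitAddTorus.span_mFourier_closure_eq_top]; trivial
    exact closure_minimal hspan hclosed this
  have hzero : hg.toLp g = 0 := by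
    have hd := ContinuousMap.toLp_denseRange ℂ m ℂ (p := 2) (by simp)
    have hcl : IsClosed {v : Lp ℂ 2 m | inner ℂ v (hg.toLp g) = 0} :=
      isClosed_eq (by fun_prop) continuous_const
    have : hg.toLp g ∈ {v : Lp ℂ 2 m | inner ℂ v (hg.toLp g) = 0} :=
      closure_minimal (Set.range_subset_iff.2 hall) hcl (hd _)
    exact inner_self_eq_zero.1 this
  have := hg.coeFn_toLp
  rw [hzero] at this
  exact this.symm.trans (Lp.coeFn_zero _ _ _)

lemma ae_eq_zero_of_integral_wave {f : Rd d → ℂ} (hf : MemLp f 2 (law ω))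
    (h : ∀ k : Fin d → ℤ, ∫ x, wave (intVec k) x * f x ∂(law ω) = 0) : f =ᵐ[law ω] 0 := by
  obtain ⟨s, hs, hsec⟩ := exists_section ω
  have hπ := (measurable_toTorus (d := d)).aemeasurable (μ := law ω)
  have hmap : ((law ω).map toTorus).map s = law ω := by
    rw [Measure.map_map hs measurable_toTorus]
    conv_rhs => rw [← Measure.map_id (μ := law ω)]
    exact Measure.map_congr hsec
  have hg : MemLp (f ∘ s) 2 ((law ω).map toTorus) := by
    rw [← memLp_map_measure_iff _ hs.aemeasurable, hmap]
    · exact hf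
    · rw [hmap]; exact hf.1
  have hcomp : (f ∘ s) ∘ toTorus =ᵐ[law ω] f := by
    filter_upwards [hsec] with x hx
    simp [hx]
  have : IsFiniteMeasure ((law ω).map toTorus) := by infer_instance
  have hzero := ae_eq_zero_of_torus _ hg fun k => by
    rw [integral_map (f := fun t => UnitAddTorus.mFourier k t * (f ∘ s) t) hπ
      ((map_continuous _).aestronglyMeasurable.mul hg.1), ← h k]
    refine integral_congr_ae ?_
    filter_upwards [hcomp] with x hx
    rw [wave_intVec_eq_mFourier, ← hx]
    rfl
  filter_upwards [hcomp, ae_of_ae_map hπ hzero] with x h1 h2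
  rw [← h1]
  exact h2

lemma exists_ft_add_intVec_ne_zero (ξ : Rd d) : ∃ k : Fin d → ℤ, ft ω (ξ + intVec k) ≠ 0 := by
  by_contra! h
  have hmem : MemLp (wave ξ) 2 (law ω) :=
    MemLp.of_bound (continuous_wave ξ).aestronglyMeasurable 1 (by simp)
  have h0 := ae_eq_zero_of_integral_wave ω hmem fun k => by
    rw [← h k, ft]
    simp_rw [wave_add_left, mul_comm]
  obtain ⟨x, hx⟩ := h0.exists
  exact wave_ne_zero ξ x hx

end

section

/-! ### Uniform lower bounds by compactness -/

/-- With the discrete topology, finite families of digit systems are compact, and sequences close in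
the product topology share a long initial segment. -/
instance : TopologicalSpace (DigitSystem d) := ⊥

instance : DiscreteTopology (DigitSystem d) := ⟨rfl⟩

lemma finite_setOf_m_le (C : ℤ) : {D : DigitSystem d | ∀ i, D.m i ≤ C}.Finite := by
  have hinj : Set.InjOn (fun D : DigitSystem d => (D.m, D.B)) {D | ∀ i, D.m i ≤ C} := by
    rintro ⟨m, B, _, _, _, _⟩ _ ⟨m', B', _, _, _, _⟩ _ h
    simp only [Prod.mk.injEq] at h
    obtain ⟨rfl, rfl⟩ := h
    rfl
  refine Set.Finite.of_finite_image (Set.Finite.subset (Finset.finite_toSet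
    (Finset.Icc 0 (fun _ => C) ×ˢ (Finset.Icc (0 : Fin d → ℤ) (fun _ => C)).powerset)) ?_) hinj
  rintro _ ⟨D, hD, rfl⟩
  have h2 := D.two_le
  simp only [Finset.coe_product, Set.mem_prod, Finset.mem_coe, Finset.mem_Icc,
    Finset.mem_powerset]
  refine ⟨⟨fun i => by have := h2 i; simp; omega, hD⟩, fun b hb => ?_⟩
  rw [Finset.mem_Icc]
  exact ⟨fun i => D.nonneg b hb i, fun i => by have := D.le b hb i; have := hD i; simp; omega⟩

lemma ftPart_congr {ω ω' : ℕ → DigitSystem d} {N : ℕ} (h : ∀ k < N, ω k = ω' k) (ξ : Rd d) :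
    ftPart ω N ξ = ftPart ω' N ξ := by
  refine Finset.prod_congr rfl fun k hk => ?_
  have hk := Finset.mem_range.1 hk
  have : base ω k = base ω' k :=
    Finset.prod_congr rfl fun j hj => by rw [h j ((Finset.mem_range.1 hj).trans hk)]
  rw [h k hk, this]

lemma exists_lower_bound_nhds (ω₀ : ℕ → DigitSystem d) (ξ₀ : Rd d) :
    ∃ t ∈ 𝓝 (ω₀, ξ₀), ∃ ε > 0, ∀ q ∈ t, ∃ k : Fin d → ℤ, ε ≤ ‖ft q.1 (q.2 + intVec k)‖ := by
  obtain ⟨k, hk⟩ := exists_ft_add_intVec_ne_zero ω₀ ξ₀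
  set η := ξ₀ + intVec k with hη
  set c := ‖ft ω₀ η‖
  have hc : 0 < c := norm_pos_iff.2 hk
  have hlim : Tendsto (fun N : ℕ => 2 * Real.pi * ‖η‖ * (√d * (1 / 2) ^ N)) atTop (𝓝 0) := by
    simpa using ((tendsto_pow_atTop_nhds_zero_of_lt_one (by norm_num : (0 : ℝ) ≤ 1 / 2)
      (by norm_num)).const_mul (√d)).const_mul (2 * Real.pi * ‖η‖)
  obtain ⟨N, hN⟩ := (hlim.eventually_lt_const (show 0 < c / 4 by positivity)).exists
  have hlip : Tendsto (fun ξ : Rd d => 2 * Real.pi * √d * ‖ξ - ξ₀‖) (𝓝 ξ₀) (𝓝 0) := by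
    have : Continuous fun ξ : Rd d => 2 * Real.pi * √d * ‖ξ - ξ₀‖ := by fun_prop
    simpa using this.tendsto ξ₀
  have h1 : ∀ᶠ ω in 𝓝 ω₀, ∀ j < N, ω j = ω₀ j := by
    refine (Set.finite_lt_nat N).eventually_all.2 fun j _ => ?_
    exact (continuous_apply j).continuousAt.eventually
      (by simp [nhds_discrete] : ∀ᶠ D in 𝓝 (ω₀ j), D = ω₀ j)
  have h2 := hlip.eventually_lt_const (show 0 < c / 4 by positivity)
  -- Of c, three quarters are lost: the truncation error at N for `ω₀`, the same error for `q.1`,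
  -- and the move from `ξ₀` to `q.2`.
  refine ⟨_, h1.prod_nhds h2, c / 4, by positivity, fun q hq => ⟨k, ?_⟩⟩
  obtain ⟨hq1, hq2⟩ := hq
  have e1 := norm_ftPart_sub_ft_le ω₀ N η
  have e2 := norm_ftPart_sub_ft_le q.1 N η
  have e3 := norm_ft_sub_le q.1 (q.2 + intVec k) η
  rw [ftPart_congr hq1] at e2
  rw [hη, add_sub_add_right_eq_sub, ← hη] at e3
  have t1 : c ≤ ‖ftPart ω₀ N η‖ + ‖ftPart ω₀ N η - ft ω₀ η‖ := by
    have := norm_sub_norm_le (ft ω₀ η) (ftPart ω₀ N η)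
    rw [norm_sub_rev] at this
    linarith
  have t2 := norm_sub_norm_le (ftPart ω₀ N η) (ft q.1 η)
  have t3 := norm_sub_norm_le (ft q.1 η) (ft q.1 (q.2 + intVec k))
  rw [norm_sub_rev] at t3
  linarith

lemma exists_lower_bound (C : ℤ) : ∃ ε > 0, ∀ ω : ℕ → DigitSystem d,
    (∀ n i, (ω n).m i ≤ C) → ∀ ξ, ∃ k : Fin d → ℤ, ε ≤ ‖ft ω (ξ + intVec k)‖ := by
  have hK : IsCompact ((Set.univ.pi fun _ : ℕ => {D : DigitSystem d | ∀ i, D.m i ≤ C}) ×ˢ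
      Metric.closedBall (0 : Rd d) (√d)) :=
    (isCompact_univ_pi fun _ => (finite_setOf_m_le C).isCompact).prod (isCompact_closedBall _ _)
  obtain ⟨ε, hε, h⟩ := hK.induction_on
    (p := fun s => ∃ ε > 0, ∀ q ∈ s, ∃ k : Fin d → ℤ, ε ≤ ‖ft q.1 (q.2 + intVec k)‖)
    ⟨1, one_pos, by simp⟩
    (fun s t hst ⟨ε, hε, h⟩ => ⟨ε, hε, fun q hq => h q (hst hq)⟩)
    (fun s t ⟨ε, hε, h⟩ ⟨ε', hε', h'⟩ => ⟨min ε ε', lt_min hε hε', fun q hq => by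
      rcases hq with hq | hq
      · obtain ⟨k, hk⟩ := h q hq
        exact ⟨k, (min_le_left _ _).trans hk⟩
      · obtain ⟨k, hk⟩ := h' q hq
        exact ⟨k, (min_le_right _ _).trans hk⟩⟩)
    (fun q _ => by
      obtain ⟨t, ht, h⟩ := exists_lower_bound_nhds q.1 q.2
      exact ⟨t, mem_nhdsWithin_of_mem_nhds ht, h⟩)
  refine ⟨ε, hε, fun ω hω ξ => ?_⟩
  -- Only ξ modulo ℤ^d matters, and the fractional parts stay in the compact ball.
  let fl : Fin d → ℤ := fun i => ⌊ξ i⌋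
  have hball : ‖ξ - intVec fl‖ ≤ √d := by
    have := norm_le_sqrt_mul (x := ξ - intVec fl) zero_le_one fun i => by
      change |ξ i - (⌊ξ i⌋ : ℝ)| ≤ 1
      rw [abs_le]
      constructor <;> linarith [Int.floor_le (ξ i), Int.lt_floor_add_one (ξ i)]
    simpa using this
  obtain ⟨k, hk⟩ := h (ω, ξ - intVec fl)
    ⟨fun n _ => hω n, by simpa using hball⟩
  refine ⟨k - fl, ?_⟩
  rwa [intVec_sub, ← add_sub_assoc, add_sub_right_comm]

lemma exists_uniform_lower_bound (C : ℤ) : ∃ ε > 0, ∃ δ > 0, ∀ ω : ℕ → DigitSystem d,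
    (∀ n i, (ω n).m i ≤ C) → (∀ y, ‖y‖ < δ → ε ≤ ‖ft ω y‖) ∧
      ∀ ξ, ∃ k : Fin d → ℤ, ∀ y, ‖y‖ < δ → ε ≤ ‖ft ω (ξ + intVec k + y)‖ := by
  obtain ⟨ε, hε, h⟩ := exists_lower_bound (d := d) C
  set a := min ε 1
  have ha : 0 < a := lt_min hε one_pos
  have hpos : 0 < 2 * Real.pi * (√d + 1) := by positivity
  -- The Lipschitz bound loses at most a/2 over distance δ; the `+ 1` keeps the denominator positive
  -- when d = 0.
  set δ := a / 2 / (2 * Real.pi * (√d + 1))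
  have hmove : ∀ (ω : ℕ → DigitSystem d) (ξ y : Rd d), ‖y‖ < δ → a ≤ ‖ft ω ξ‖ →
      a / 2 ≤ ‖ft ω (ξ + y)‖ := fun ω ξ y hy h0 => by
    have h1 := norm_ft_sub_le ω ξ (ξ + y)
    have h2 := norm_sub_norm_le (ft ω ξ) (ft ω (ξ + y))
    rw [sub_add_cancel_left, norm_neg] at h1
    have h3 : 2 * Real.pi * √d * ‖y‖ ≤ 2 * Real.pi * (√d + 1) * δ := by
      gcongr
      linarith
    rw [mul_div_cancel₀ _ hpos.ne'] at h3
    linarith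
  refine ⟨a / 2, by positivity, δ, by positivity, fun ω hω => ⟨fun y hy => ?_, fun ξ => ?_⟩⟩
  · have := hmove ω 0 y hy (by simp [a])
    rwa [zero_add] at this
  · obtain ⟨k, hk⟩ := h ω hω ξ
    exact ⟨k, fun y hy => hmove ω _ y hy ((min_le_left _ _).trans hk)⟩

end

section

/-! ### Spectra of the partial convolutions -/

/-- `L` is dual to the digits of `D`: it is a spectrum of `δ_{R⁻¹B}`. -/
def IsDual (D : DigitSystem d) (L : Finset (Fin d → ℤ)) : Prop :=
  ∀ ξ, ∑ l ∈ L, ‖mask D (ξ + intVec l)‖ ^ 2 = 1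

/-- Expanding the square gives a double sum over digits; orthogonality kills the terms off the
diagonal, and the diagonal ones have modulus-one factors independent of ξ after conjugation. -/
lemma isDual_of_orthogonal {D : DigitSystem d} {L : Finset (Fin d → ℤ)}
    (h : ∀ b ∈ D.B, ∀ c ∈ D.B, ∑ l ∈ L, (starRingEnd ℂ) (wave (intVec l) (scale D.m (intVec b))) *
      wave (intVec l) (scale D.m (intVec c)) = if b = c then (D.B.card : ℂ) else 0) :
    IsDual D L := by
  intro ξ
  have hn : (D.B.card : ℂ) ≠ 0 := by exact_mod_cast D.nonempty.card_pos.ne'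
  set n : ℂ := (D.B.card : ℂ) with hn_def
  let u : Rd d → (Fin d → ℤ) → ℂ := fun η b => wave η (scale D.m (intVec b))
  have hterm : ∀ l, ((‖mask D (ξ + intVec l)‖ ^ 2 : ℝ) : ℂ) = n⁻¹ * n⁻¹ * ∑ b ∈ D.B, ∑ c ∈ D.B,
      ((starRingEnd ℂ) (u ξ b) * u ξ c) * ((starRingEnd ℂ) (u (intVec l) b) * u (intVec l) c) := by
    intro l
    push_cast
    rw [← Complex.conj_mul', mask, map_mul, map_inv₀, Complex.conj_natCast, map_sum,
      mul_mul_mul_comm, Finset.sum_mul_sum]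
    congr 1
    refine Finset.sum_congr rfl fun b _ => Finset.sum_congr rfl fun c _ => ?_
    simp only [wave_add_left, map_mul, u]
    ring
  have : ((∑ l ∈ L, ‖mask D (ξ + intVec l)‖ ^ 2 : ℝ) : ℂ) = 1 := by
    rw [Complex.ofReal_sum, Finset.sum_congr rfl fun l _ => hterm l, ← Finset.mul_sum,
      Finset.sum_comm]
    have hb : ∀ b ∈ D.B, ∑ l ∈ L, ∑ c ∈ D.B, ((starRingEnd ℂ) (u ξ b) * u ξ c) *
        ((starRingEnd ℂ) (u (intVec l) b) * u (intVec l) c) = n := by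
      intro b hb
      rw [Finset.sum_comm]
      simp_rw [← Finset.mul_sum]
      rw [Finset.sum_congr rfl fun c hc => by rw [h b hb c hc]]
      simp [hb, u, Complex.conj_mul']
    rw [Finset.sum_congr rfl hb, Finset.sum_const, nsmul_eq_mul, ← hn_def]
    field_simp
  exact_mod_cast this

/-- Duality is required for all ξ, so it is translation invariant. Having 0 in the dual set is what
makes successive spectra nested. -/
lemma IsDual.exists_zero_mem {D : DigitSystem d} {L : Finset (Fin d → ℤ)} (h : IsDual D L) :
    ∃ L', 0 ∈ L' ∧ IsDual D L' := by
  have hne : L.Nonempty := by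
    rw [Finset.nonempty_iff_ne_empty]
    rintro rfl
    simpa using h 0
  obtain ⟨a, ha⟩ := hne
  refine ⟨L.map (Equiv.subRight a).toEmbedding, by simpa using ha, fun ξ => ?_⟩
  rw [Finset.sum_map, ← h (ξ - intVec a)]
  refine Finset.sum_congr rfl fun l _ => ?_
  simp only [Equiv.coe_toEmbedding, Equiv.subRight_apply, intVec_sub]
  congr 3
  abel

lemma IsAdmissiblePair.exists_isDual {D : DigitSystem d}
    (h : IsAdmissiblePair (Matrix.diagonal D.m) D.B) : ∃ L, 0 ∈ L ∧ IsDual D L := by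
  obtain ⟨-, L, -, hH, -⟩ := h
  refine (isDual_of_orthogonal (L := L) fun b hb c hc => ?_).exists_zero_mem
  have hm : ∀ i, D.m i ≠ 0 := fun i => by have := D.two_le i; omega
  have hn : (0 : ℝ) < D.B.card := by exact_mod_cast D.nonempty.card_pos
  have hentry : ∀ (b : D.B) (l : L), hadamardMatrix (Matrix.diagonal D.m) D.B L b l =
      ((1 / √(D.B.card : ℝ) : ℝ) : ℂ) *
        (starRingEnd ℂ) (wave (intVec l) (scale D.m (intVec b))) := by
    intro b l
    rw [← wave_neg_right, hadamardMatrix, Matrix.of_apply, invApply_diagonal hm, wave,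
      inner_neg_right, real_inner_comm]
    congr 2
    push_cast
    ring
  have h1 := congrFun (congrFun hH ⟨b, hb⟩) ⟨c, hc⟩
  simp only [Matrix.mul_apply, Matrix.conjTranspose_apply, hentry, Matrix.one_apply,
    Subtype.mk.injEq] at h1
  have hsq : ((1 / √(D.B.card : ℝ) : ℝ) : ℂ) * ((1 / √(D.B.card : ℝ) : ℝ) : ℂ) =
      (D.B.card : ℂ)⁻¹ := by
    rw [← Complex.ofReal_mul, div_mul_div_comm, Real.mul_self_sqrt hn.le]
    simp
  have h2 : (D.B.card : ℂ)⁻¹ * ∑ l ∈ L, (starRingEnd ℂ) (wave (intVec l) (scale D.m (intVec b))) *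
      wave (intVec l) (scale D.m (intVec c)) = if b = c then 1 else 0 := by
    rw [← h1, ← hsq, Finset.mul_sum, ← Finset.sum_coe_sort L]
    refine Finset.sum_congr rfl fun l _ => ?_
    rw [star_mul', RCLike.star_def, Complex.conj_conj, Complex.conj_ofReal]
    ring
  have hn' : (D.B.card : ℂ) ≠ 0 := by exact_mod_cast hn.ne'
  rw [inv_mul_eq_iff_eq_mul₀ hn'] at h2
  rw [h2]
  split_ifs <;> simp

@[simp] lemma mask_zero (D : DigitSystem d) : mask D 0 = 1 := by
  have hn : (D.B.card : ℂ) ≠ 0 := by exact_mod_cast D.nonempty.card_pos.ne'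
  simp [mask, hn]

@[simp] lemma scale_zero (p : Fin d → ℤ) : scale p 0 = 0 := by
  ext i; simp

variable (ω : ℕ → DigitSystem d)

@[simp] lemma ftPart_zero_right (n : ℕ) : ftPart ω n 0 = 1 := by simp [ftPart]

/-- `Λ` is a spectrum of the `n`-th partial convolution. -/
def IsPartSpectrum (n : ℕ) (Λ : Finset (Fin d → ℤ)) : Prop :=
  ∀ ξ, ∑ l ∈ Λ, ‖ftPart ω n (ξ + intVec l)‖ ^ 2 = 1

variable {ω} {n : ℕ} {Λ : Finset (Fin d → ℤ)}

/-- At ξ = −l the term of l alone is already 1, so all the others vanish. -/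
lemma IsPartSpectrum.ftPart_sub_eq_zero (h : IsPartSpectrum ω n Λ) {k l : Fin d → ℤ} (hk : k ∈ Λ)
    (hl : l ∈ Λ) (hkl : k ≠ l) : ftPart ω n (intVec k - intVec l) = 0 := by
  have h1 := h (-intVec l)
  rw [← Finset.add_sum_erase _ _ hl, neg_add_cancel, ftPart_zero_right] at h1
  have h2 : ∑ x ∈ Λ.erase l, ‖ftPart ω n (-intVec l + intVec x)‖ ^ 2 = 0 := by
    simpa using h1
  rw [Finset.sum_eq_zero_iff_of_nonneg fun _ _ => by positivity] at h2
  have := h2 k (Finset.mem_erase.2 ⟨hkl, hk⟩)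
  rwa [sq_eq_zero_iff, norm_eq_zero, neg_add_eq_sub] at this

/-- For distinct congruent points, periodicity would turn the vanishing value at k − l into the
value 1 at 0. -/
lemma IsPartSpectrum.eq_of_add_eq_add (h : IsPartSpectrum ω n Λ) {k l a b : Fin d → ℤ} (hk : k ∈ Λ)
    (hl : l ∈ Λ) (hkl : k + base ω n * a = l + base ω n * b) : k = l := by
  by_contra hne
  have h0 := h.ftPart_sub_eq_zero hk hl hne
  have : k - l = 0 + base ω n * (b - a) := by
    rw [mul_sub, zero_add, sub_eq_sub_iff_add_eq_add, hkl, add_comm]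
  rw [← intVec_sub, this, intVec_add, ftPart_add_base_mul] at h0
  simp at h0

lemma IsPartSpectrum.image_add (h : IsPartSpectrum ω n Λ) (k : (Fin d → ℤ) → Fin d → ℤ) :
    IsPartSpectrum ω n (Λ.image fun l => l + base ω n * k l) := by
  intro ξ
  rw [Finset.sum_image fun l hl l' hl' e => h.eq_of_add_eq_add hl hl' e, ← h ξ]
  refine Finset.sum_congr rfl fun l _ => ?_
  rw [intVec_add, ← add_assoc, ftPart_add_base_mul]

lemma IsPartSpectrum.succ (h : IsPartSpectrum ω n Λ) {L : Finset (Fin d → ℤ)}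
    (hL : IsDual (ω n) L) :
    IsPartSpectrum ω (n + 1) ((Λ ×ˢ L).image fun q => q.1 + base ω n * q.2) := by
  intro ξ
  rw [Finset.sum_image, Finset.sum_product, ← h ξ]
  · refine Finset.sum_congr rfl fun l _ => ?_
    have : ∀ a, ‖ftPart ω (n + 1) (ξ + intVec (l + base ω n * a))‖ ^ 2 =
        ‖ftPart ω n (ξ + intVec l)‖ ^ 2 *
          ‖mask (ω n) (scale (base ω n) (ξ + intVec l) + intVec a)‖ ^ 2 := fun a => by
      rw [ftPart, Finset.prod_range_succ, ← ftPart, norm_mul, mul_pow, intVec_add, ← add_assoc,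
        ftPart_add_base_mul, scale_add _ (ξ + intVec l), scale_mul_intVec (base_ne_zero ω n)]
    simp only [this]
    rw [← Finset.mul_sum, hL, mul_one]
  · rintro ⟨l, a⟩ hl ⟨l', a'⟩ hl' e
    simp only [Finset.coe_product, Set.mem_prod, Finset.mem_coe] at hl hl'
    obtain rfl := h.eq_of_add_eq_add hl.1 hl'.1 e
    have e' : base ω n * a = base ω n * a' := add_left_cancel e
    congr 1
    funext i
    exact mul_left_cancel₀ (base_ne_zero ω n i) (congrFun e' i)

lemma IsPartSpectrum.exists_superset (hdual : ∀ n, ∃ L, 0 ∈ L ∧ IsDual (ω n) L)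
    (h : IsPartSpectrum ω n Λ) {N : ℕ} (hN : n ≤ N) : ∃ Λ', Λ ⊆ Λ' ∧ IsPartSpectrum ω N Λ' := by
  induction N, hN using Nat.le_induction with
  | base => exact ⟨Λ, subset_rfl, h⟩
  | succ N _ ih =>
    obtain ⟨Λ', hsub, h'⟩ := ih
    obtain ⟨L, h0, hL⟩ := hdual N
    refine ⟨_, fun l hl => ?_, h'.succ hL⟩
    exact Finset.mem_image.2 ⟨(l, 0), Finset.mem_product.2 ⟨hsub hl, h0⟩, by simp⟩

lemma isPartSpectrum_zero : IsPartSpectrum ω 0 {0} := by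
  intro ξ; simp [ftPart]

/-! ### The spectrum of the infinite convolution -/

/-- A spectrum of the `n`-th partial convolution on which the Fourier transform of the tail
is bounded below by `ε`, also after translations by vectors of norm less than `δ`. -/
def IsGoodSpectrum (ω : ℕ → DigitSystem d) (ε δ : ℝ) (n : ℕ) (Λ : Finset (Fin d → ℤ)) : Prop :=
  IsPartSpectrum ω n Λ ∧ ∀ l ∈ Λ, ∀ y, ‖y‖ < δ →
    ε ≤ ‖ft (shift n ω) (scale (base ω n) (intVec l) + y)‖

lemma tendsto_scale_base (x : Rd d) :
    Tendsto (fun n => scale (base ω n) x) atTop (𝓝 0) := by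
  rw [tendsto_zero_iff_norm_tendsto_zero]
  refine squeeze_zero (fun _ => norm_nonneg _) (fun n => norm_scale_base_le ω n x) ?_
  simpa using ((tendsto_pow_atTop_nhds_zero_of_lt_one (by norm_num : (0 : ℝ) ≤ 1 / 2)
    (by norm_num)).mul_const ‖x‖).const_mul (√d)

lemma IsPartSpectrum.exists_isGoodSpectrum (hdual : ∀ n, ∃ L, 0 ∈ L ∧ IsDual (ω n) L) {ε δ : ℝ}
    (hδ : 0 < δ) (hlow : ∀ N, (∀ y, ‖y‖ < δ → ε ≤ ‖ft (shift N ω) y‖) ∧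
      ∀ ξ, ∃ k : Fin d → ℤ, ∀ y, ‖y‖ < δ → ε ≤ ‖ft (shift N ω) (ξ + intVec k + y)‖)
    (h : IsPartSpectrum ω n Λ) :
    ∃ N Λ', n < N ∧ Λ ⊆ Λ' ∧ IsGoodSpectrum ω ε (δ / 2) N Λ' := by
  classical
  have hev : ∀ᶠ N in atTop, ∀ l ∈ Λ, ‖scale (base ω N) (intVec l)‖ < δ / 2 := by
    refine (Finset.eventually_all Λ).2 fun l _ => ?_
    have := (tendsto_scale_base (ω := ω) (intVec l)).norm
    rw [norm_zero] at this
    exact this.eventually_lt_const (by positivity)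
  obtain ⟨N, hN, hnN⟩ := (hev.and (eventually_gt_atTop n)).exists
  obtain ⟨Λ', hsub, h'⟩ := h.exists_superset hdual hnN.le
  choose k hk using fun l : Fin d → ℤ => (hlow N).2 (scale (base ω N) (intVec l))
  -- Old points stay fixed: their rescalings have norm below δ/2, which with ‖y‖ < δ/2 remains in
  -- the ball around 0. Only new points are moved.
  refine ⟨N, Λ'.image fun l => l + base ω N * (if l ∈ Λ then 0 else k l), hnN, fun l hl => ?_,
    h'.image_add _, fun l hl y hy => ?_⟩
  · exact Finset.mem_image.2 ⟨l, hsub hl, by simp [hl]⟩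
  · obtain ⟨l, -, rfl⟩ := Finset.mem_image.1 hl
    by_cases hlΛ : l ∈ Λ
    · simp only [hlΛ, if_true, mul_zero, add_zero]
      refine (hlow N).1 _ ((norm_add_le _ _).trans_lt ?_)
      linarith [hN l hlΛ]
    · simp only [hlΛ, if_false, intVec_add, scale_add]
      rw [scale_mul_intVec (base_ne_zero ω N)]
      exact hk l y (by linarith)

lemma exists_isGoodSpectrum_seq (hdual : ∀ n, ∃ L, 0 ∈ L ∧ IsDual (ω n) L) {ε δ : ℝ}
    (hδ : 0 < δ) (hlow : ∀ N, (∀ y, ‖y‖ < δ → ε ≤ ‖ft (shift N ω) y‖) ∧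
      ∀ ξ, ∃ k : Fin d → ℤ, ∀ y, ‖y‖ < δ → ε ≤ ‖ft (shift N ω) (ξ + intVec k + y)‖) :
    ∃ (n : ℕ → ℕ) (Λ : ℕ → Finset (Fin d → ℤ)), StrictMono n ∧ Monotone Λ ∧
      ∀ j, IsGoodSpectrum ω ε (δ / 2) (n j) (Λ j) := by
  have hnext : ∀ p : {p : ℕ × Finset (Fin d → ℤ) // IsGoodSpectrum ω ε (δ / 2) p.1 p.2},
      ∃ q : {p : ℕ × Finset (Fin d → ℤ) // IsGoodSpectrum ω ε (δ / 2) p.1 p.2},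
        p.1.1 < q.1.1 ∧ p.1.2 ⊆ q.1.2 := fun p => by
    obtain ⟨N, Λ', h1, h2, h3⟩ := p.2.1.exists_isGoodSpectrum hdual hδ hlow
    exact ⟨⟨(N, Λ'), h3⟩, h1, h2⟩
  choose next h1 h2 using hnext
  obtain ⟨N, Λ₀, -, -, h0⟩ :=
    (isPartSpectrum_zero (ω := ω)).exists_isGoodSpectrum hdual hδ hlow
  let s : ℕ → {p : ℕ × Finset (Fin d → ℤ) // IsGoodSpectrum ω ε (δ / 2) p.1 p.2} :=
    fun j => Nat.rec ⟨(N, Λ₀), h0⟩ (fun _ p => next p) j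
  exact ⟨fun j => (s j).1.1, fun j => (s j).1.2, strictMono_nat_of_lt_succ fun j => h1 (s j),
    monotone_nat_of_le_succ fun j => h2 (s j), fun j => (s j).2⟩

end

/-! ### Parseval identity and completeness in L² -/

section

variable {ω : ℕ → DigitSystem d}

/-- The character `wave ξ` as an element of `L²` of the infinite convolution. -/
def waveLp (ω : ℕ → DigitSystem d) (ξ : Rd d) : Lp ℂ 2 (law ω) :=
  (MemLp.of_bound (continuous_wave ξ).aestronglyMeasurable 1 (by simp) :
    MemLp (wave ξ) 2 (law ω)).toLp

lemma coeFn_waveLp (ξ : Rd d) : waveLp ω ξ =ᵐ[law ω] wave ξ := MemLp.coeFn_toLp _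

lemma inner_waveLp_left (ξ : Rd d) (f : Lp ℂ 2 (law ω)) :
    inner ℂ (waveLp ω ξ) f = ∫ x, wave (-ξ) x * f x ∂(law ω) := by
  rw [L2.inner_def]
  refine integral_congr_ae ?_
  filter_upwards [coeFn_waveLp (ω := ω) ξ] with x hx
  rw [hx, RCLike.inner_apply, wave_neg_left, mul_comm]

lemma inner_waveLp (ξ η : Rd d) : inner ℂ (waveLp ω ξ) (waveLp ω η) = ft ω (η - ξ) := by
  rw [inner_waveLp_left, ft]
  refine integral_congr_ae ?_
  filter_upwards [coeFn_waveLp (ω := ω) η] with x hx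
  rw [hx, sub_eq_neg_add, wave_add_left]

lemma norm_waveLp (ξ : Rd d) : ‖waveLp ω ξ‖ = 1 := by
  rw [@norm_eq_sqrt_re_inner ℂ, inner_waveLp]; simp

/-- If Bessel's inequality for `x` is an equality, then `x` lies in the closed span. -/
lemma mem_closure_span_of_tsum_inner_sq {E ι : Type*} [NormedAddCommGroup E]
    [InnerProductSpace ℂ E] [CompleteSpace E] {v : ι → E} (hv : Orthonormal ℂ v) {x : E}
    (h : ∑' i, ‖inner ℂ (v i) x‖ ^ 2 = ‖x‖ ^ 2) :
    x ∈ (Submodule.span ℂ (Set.range v)).topologicalClosure := by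
  set U := (Submodule.span ℂ (Set.range v)).topologicalClosure
  have hv_mem : ∀ i, v i ∈ U := fun i =>
    Submodule.le_topologicalClosure _ (Submodule.subset_span ⟨i, rfl⟩)
  have hinner : ∀ i, inner ℂ (v i) (U.starProjection x) = inner ℂ (v i) x := fun i => by
    rw [← Submodule.inner_starProjection_left_eq_right,
      Submodule.starProjection_eq_self_iff.2 (hv_mem i)]
  have hB := hv.tsum_inner_products_le (U.starProjection x)
  simp_rw [hinner] at hB
  rw [h] at hB
  rw [Submodule.mem_iff_norm_starProjection]
  exact le_antisymm (U.norm_starProjection_apply_le x)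
    (le_of_sq_le_sq hB (norm_nonneg _))

lemma isSpectrum_law {Λ : Set (Rd d)} (hΛ : Λ.Countable)
    (horth : ∀ l ∈ Λ, ∀ l' ∈ Λ, l ≠ l' → ft ω (l - l') = 0)
    (hsum : ∀ k : Fin d → ℤ, Summable (fun l : Λ => ‖ft ω (intVec k - l)‖ ^ 2) →
      ∑' l : Λ, ‖ft ω (intVec k - l)‖ ^ 2 = 1) : IsSpectrum (law ω) Λ := by
  have hon : Orthonormal ℂ fun l : Λ => waveLp ω l := by
    refine ⟨fun l => norm_waveLp _, fun l l' hne => ?_⟩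
    change inner ℂ (waveLp ω l) (waveLp ω l') = 0
    rw [inner_waveLp]
    exact horth l' l'.2 l l.2 fun e => hne (Subtype.ext e.symm)
  have hspan : (Submodule.span ℂ (Set.range fun l : Λ => waveLp ω l))ᗮ = ⊥ := by
    rw [← Submodule.orthogonal_closure, eq_bot_iff]
    intro f hf
    have hzero := ae_eq_zero_of_integral_wave ω (Lp.memLp f) fun k => by
      rw [← neg_neg (intVec k), ← inner_waveLp_left]
      -- Since `f` is orthogonal to the closed span, it suffices that integral exponentials lie in
      -- it.
      refine hf _ (mem_closure_span_of_tsum_inner_sq hon ?_)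
      have hB := hon.inner_products_summable (waveLp ω (intVec (-k)))
      have hneg : intVec (-k) = -intVec k := by ext i; simp
      simp only [inner_waveLp, hneg] at hB
      rw [norm_waveLp, one_pow]
      simp only [inner_waveLp, ← hneg] at hB ⊢
      exact hsum (-k) hB
    exact (Submodule.mem_bot ℂ).2 (Lp.eq_zero_iff_ae_eq_zero.2 hzero)
  refine ⟨hΛ, HilbertBasis.mkOfOrthogonalEqBot hon hspan, fun l => ?_⟩
  rw [HilbertBasis.coe_mkOfOrthogonalEqBot]
  exact coeFn_waveLp _

lemma ft_neg (ξ : Rd d) : ft ω (-ξ) = (starRingEnd ℂ) (ft ω ξ) := by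
  rw [ft, ft, ← integral_conj]
  simp_rw [wave_neg_left]

lemma tsum_norm_ft_sq {ε δ : ℝ} (hε : 0 < ε) (hδ : 0 < δ) {n : ℕ → ℕ}
    {Λ : ℕ → Finset (Fin d → ℤ)} (hn : StrictMono n) (hΛ : Monotone Λ)
    (h : ∀ j, IsGoodSpectrum ω ε δ (n j) (Λ j)) (ξ : Rd d)
    (hs : Summable fun l : intVec '' (⋃ j, (Λ j : Set (Fin d → ℤ))) => ‖ft ω (ξ + l)‖ ^ 2) :
    ∑' l : intVec '' (⋃ j, (Λ j : Set (Fin d → ℤ))), ‖ft ω (ξ + l)‖ ^ 2 = 1 := by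
  classical
  set A : Set (Rd d) := intVec '' (⋃ j, (Λ j : Set (Fin d → ℤ)))
  let F : ℕ → Finset (Rd d) := fun j => (Λ j).map ⟨intVec, intVec_injective⟩
  have hFA : ∀ j, ∀ x ∈ F j, x ∈ A := fun j x hx => by
    obtain ⟨l, hl, rfl⟩ := Finset.mem_map.1 hx
    exact ⟨l, Set.mem_iUnion.2 ⟨j, hl⟩, rfl⟩
  let f : ℕ → A → ℝ := fun j l => if (l : Rd d) ∈ F j then ‖ftPart ω (n j) (ξ + l)‖ ^ 2 else 0
  have hf : ∀ j, ∑' l, f j l = 1 := fun j => by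
    rw [tsum_subtype A fun x => if x ∈ F j then ‖ftPart ω (n j) (ξ + x)‖ ^ 2 else 0,
      tsum_eq_sum (s := F j) fun x hx => by simp [Set.indicator_apply, hx], ← (h j).1 ξ,
      Finset.sum_map]
    refine Finset.sum_congr rfl fun l hl => ?_
    have hmem : intVec l ∈ F j := Finset.mem_map.2 ⟨l, hl, rfl⟩
    simp [hFA j _ hmem, hmem]
  have hlim : ∀ l : A, Tendsto (fun j => f j l) atTop (𝓝 (‖ft ω (ξ + l)‖ ^ 2)) := by
    rintro ⟨_, l, hl, rfl⟩
    obtain ⟨J, hJ⟩ := Set.mem_iUnion.1 hl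
    have h1 := (((tendsto_ftPart ω (ξ + intVec l)).comp hn.tendsto_atTop).norm).pow 2
    refine h1.congr' ?_
    filter_upwards [eventually_ge_atTop J] with j hj
    have hmem : intVec l ∈ F j := Finset.mem_map.2 ⟨l, hΛ hj hJ, rfl⟩
    simp [f, hmem]
  have hsmall : ∀ᶠ j in atTop, ‖scale (base ω (n j)) ξ‖ < δ := by
    have := ((tendsto_scale_base (ω := ω) ξ).comp hn.tendsto_atTop).norm
    rw [norm_zero] at this
    exact this.eventually_lt_const hδ
  have hbound : ∀ᶠ j in atTop, ∀ l : A, ‖f j l‖ ≤ (ε⁻¹) ^ 2 * ‖ft ω (ξ + l)‖ ^ 2 := by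
    filter_upwards [hsmall] with j hj l
    by_cases hmem : (l : Rd d) ∈ F j
    · obtain ⟨a, ha, hal⟩ := Finset.mem_map.1 hmem
      -- The margin δ is spent here: the perturbation is the rescaled ξ, small for large j. The tail
      -- factor is thus at least ε, and the finite factor is dominated.
      have h1 := (h j).2 a ha _ hj
      have h2 := ft_eq_mul ω (n j) (ξ + l)
      rw [scale_add, add_comm (scale _ ξ), ← hal] at h2
      have h3 : ‖ftPart ω (n j) (ξ + l)‖ ≤ ε⁻¹ * ‖ft ω (ξ + l)‖ := by
        rw [inv_mul_eq_div, le_div_iff₀ hε, ← hal, h2, norm_mul]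
        exact mul_le_mul_of_nonneg_left h1 (norm_nonneg _)
      simp only [f, hmem, if_true, norm_pow, norm_norm]
      rw [← mul_pow]
      exact pow_le_pow_left₀ (norm_nonneg _) h3 2
    · simp only [f, hmem, if_false, norm_zero]
      positivity
  have := tendsto_tsum_of_dominated_convergence (hs.mul_left _) hlim hbound
  simp_rw [hf] at this
  exact (tendsto_nhds_unique this tendsto_const_nhds)

lemma exists_isSpectrum_law (hdual : ∀ n, ∃ L, 0 ∈ L ∧ IsDual (ω n) L) {C : ℤ}
    (hC : ∀ n i, (ω n).m i ≤ C) : ∃ Λ ⊆ intLattice d, IsSpectrum (law ω) Λ := by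
  obtain ⟨ε, hε, δ, hδ, hlow⟩ := exists_uniform_lower_bound (d := d) C
  obtain ⟨n, Λ, hn, hΛ, hgood⟩ := exists_isGoodSpectrum_seq hdual hδ
    fun N => hlow (shift N ω) fun k => hC (N + k)
  refine ⟨intVec '' (⋃ j, (Λ j : Set (Fin d → ℤ))), Set.image_subset_range _ _,
    isSpectrum_law ((Set.to_countable _).image _) ?_ fun k hs => ?_⟩
  · rintro _ ⟨l, hl, rfl⟩ _ ⟨l', hl', rfl⟩ hne
    obtain ⟨j, hj⟩ := Set.mem_iUnion.1 hl
    obtain ⟨j', hj'⟩ := Set.mem_iUnion.1 hl'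
    rw [ft_eq_mul ω (n (max j j')), (hgood (max j j')).1.ftPart_sub_eq_zero
      (hΛ (le_max_left j j') hj) (hΛ (le_max_right j j') hj') fun e => hne (by rw [e]), zero_mul]
  · have hflip : ∀ l : Rd d, ‖ft ω (intVec k - l)‖ = ‖ft ω (-intVec k + l)‖ := fun l => by
      rw [← neg_sub, ft_neg, RCLike.norm_conj, sub_eq_neg_add]
    simp only [hflip] at hs ⊢
    exact tsum_norm_ft_sq hε (by positivity) hn hΛ hgood _ hs

/-- The matrix is applied to the i-th unit vector. -/
lemma diagonal_le_opNorm (m : Fin d → ℤ) (i : Fin d) :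
    (m i : ℝ) ≤ opNorm (Matrix.diagonal m) := by
  have h := (Matrix.toEuclideanCLM (n := Fin d) (𝕜 := ℝ)
    (realMat (Matrix.diagonal m))).le_opNorm (EuclideanSpace.single i 1)
  rw [PiLp.norm_single, norm_one, mul_one] at h
  refine le_trans ?_ h
  refine le_trans ?_ (PiLp.norm_apply_le _ i)
  refine le_trans (le_of_eq ?_) (le_abs_self _)
  rw [realMat, Matrix.diagonal_map (by simp)]
  simp [Matrix.mulVec_diagonal]

end

end InfConv

end

theorem theorem1p6 (d : ℕ) (R : ℕ → Matrix (Fin d) (Fin d) ℤ) (B : ℕ → Finset (Fin d → ℤ))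
    (hadm : ∀ n, InfConv.IsAdmissiblePair (R n) (B n))
    (hD : ∀ n, InfConv.MemD (R n) (B n))
    (hbdd : BddAbove (Set.range fun n => InfConv.opNorm (R n))) :
    ∃ μ : Measure (InfConv.Rd d), InfConv.IsInfiniteConvolution R B μ ∧
      ∃ Λ : Set (InfConv.Rd d), Λ ⊆ InfConv.intLattice d ∧ InfConv.IsSpectrum μ Λ := by
  choose m hm hR hB hdig using hD
  let ω : ℕ → InfConv.DigitSystem d := fun n =>
    ⟨m n, B n, hm n, hB n, fun b hb i => (hdig n b hb i).1, fun b hb i => (hdig n b hb i).2⟩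
  obtain ⟨C, hC⟩ := hbdd
  have hbound : ∀ n i, (ω n).m i ≤ ⌊C⌋ := fun n i => by
    rw [Int.le_floor]
    refine (InfConv.diagonal_le_opNorm (m n) i).trans ?_
    rw [← hR n]
    exact hC ⟨n, rfl⟩
  refine ⟨InfConv.law ω, InfConv.isInfiniteConvolution_law hR fun _ => rfl,
    InfConv.exists_isSpectrum_law (fun n => ?_) hbound⟩
  refine InfConv.IsAdmissiblePair.exists_isDual (D := ω n) ?_
  have := hadm n
  rwa [hR n] at this
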